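/- Let $n\ge 0$ be an integer. An $n$-dimensional finite signed measure on a measurable space $(S,\mathcal F)$ is an $n$-tuple $\vec\alpha=(\alpha_1,\dots,\alpha_n)$ of finite signed measures on $(S,\mathcal F)$; its Lorenz skeleton is its range $$\mathsf{LS}(\vec\alpha)=\{(\alpha_1(A),\dots,\alpha_n(A)) : A\in\mathcal F\}\subseteq\mathbb R^n .$$ For such $\vec\alpha$ on $(S,\mathcal F)$ and $\vec\beta$ on $(T,\mathcal G)$ let $\vec\alpha\times\vec\beta=(\alpha_1\times\beta_1,\dots,\alpha_n\times\beta_n)$, where $\alpha_i\times\beta_i$ is the unique finite signed measure on $S\times T$ with the product $\sigma$-algebra such that $(\alpha_i\times\beta_i)(A\times B)=\alpha_i(A)\beta_i(B)$ for all $A\in\mathcal F$, $B\in\mathcal G$. Let $d_{\mathrm H}$ be the Hausdorff distance on subsets of $\mathbb R^n$ induced by the $1$-norm. 1. Let $\vec\alpha$, $\vec\beta$ be $n$-dimensional finite signed measures. For every $\varepsilon>0$ there is $\delta>0$ such that $d_{\mathrm H}\big(\mathsf{LS}(\vec\alpha\times\vec\beta),\mathsf{LS}(\vec\alpha'\times\vec\beta')\big)<\varepsilon$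 for all $n$-dimensional finite signed measures $\vec\alpha'$, $\vec\beta'$ (on arbitrary measurable spaces) with $d_{\mathrm H}\big(\mathsf{LS}(\vec\alpha),\mathsf{LS}(\vec\alpha')\big)<\delta$ and $d_{\mathrm H}\big(\mathsf{LS}(\vec\beta),\mathsf{LS}(\vec\beta')\big)<\delta$. 2. If $\mathsf{LS}(\vec\alpha)=\mathsf{LS}(\vec\alpha')$ and $\mathsf{LS}(\vec\beta)=\mathsf{LS}(\vec\beta')$, then $\mathsf{LS}(\vec\alpha\times\vec\beta)=\mathsf{LS}(\vec\alpha'\times\vec\beta')$. 3. Consequently there is exactly one binary operation $(K,L)\mapsto KL$ on the set of Lorenz skeletons in $\mathbb R^n$ such that $\mathsf{LS}(\vec\alpha)\,\mathsf{LS}(\vec\beta)=\mathsf{LS}(\vec\alpha\times\vec\beta)$ for all $n$-dimensional finite signed measures $\vec\alpha$, $\vec\beta$. 4. This operation is continuous for the Hausdorff distance: for all Lorenz skeletons $K$, $L$ in $\mathbb R^n$ and every $\varepsilon>0$ there is $\delta>0$ such that $d_{\mathrm H}(KL,K'L')<\varepsilon$ for all Lorenz skeletons $K'$, $L'$ in $\mathbb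 R^n$ with $d_{\mathrm H}(K,K')<\delta$ and $d_{\mathrm H}(L,L')<\delta$. -/

import Mathlib

open MeasureTheory

universe u₁ v₁ u₂ v₂

/-- `ℝⁿ` with the `1`-norm `‖x‖₁ = ∑ i, |x i|`. -/
abbrev RealVec (n : ℕ) : Type := PiLp 1 (fun _ : Fin n => ℝ)

/-- An `n`-dimensional finite signed measure on `S`: an `n`-tuple of finite signed measures
on the common measurable space `S` (Mathlib's `SignedMeasure` is real-valued, hence finite). -/
abbrev SignedVecMeasure (n : ℕ) (S : Type*) [MeasurableSpace S] : Type _ :=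
  Fin n → SignedMeasure S

namespace SignedVecMeasure

/-- The value `(α₁(A), …, αₙ(A))` of a signed vector measure at a set `A`. -/
noncomputable def eval {n : ℕ} {S : Type*} [MeasurableSpace S] (α : SignedVecMeasure n S)
    (A : Set S) : RealVec n :=
  WithLp.toLp 1 (fun i => α i A)

/-- The Lorenz skeleton of a signed vector measure, i.e. its range. -/
def skeleton {n : ℕ} {S : Type*} [MeasurableSpace S] (α : SignedVecMeasure n S) :
    Set (RealVec n) :=
  {x | ∃ A : Set S, MeasurableSet A ∧ α.eval A = x}

/-- The coordinatewise product `(α₁ × β₁, …, αₙ × βₙ)`, a signed vector measure on `S × T` with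
the product `σ`-algebra. The product of two signed measures is Mathlib's product of vector
measures with respect to the multiplication of `ℝ`; it always exists and is determined by its
values on measurable rectangles, see `prod_rectangle` and `eq_prod_of_rectangle`. -/
noncomputable def prod {n : ℕ} {S T : Type*} [MeasurableSpace S] [MeasurableSpace T]
    (α : SignedVecMeasure n S) (β : SignedVecMeasure n T) : SignedVecMeasure n (S × T) :=
  fun i => VectorMeasure.prod (α i) (β i) (ContinuousLinearMap.mul ℝ ℝ)

theorem prod_rectangle {n : ℕ} {S T : Type*} [MeasurableSpace S] [MeasurableSpace T]
    (α : SignedVecMeasure n S) (β : SignedVecMeasure n T) (i : Fin n) (A : Set S) (B : Set T) :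
    α.prod β i (A ×ˢ B) = α i A * β i B := by
  have h : IsFiniteMeasure (α i).variation := by
    rw [← SignedMeasure.totalVariation_eq_variation]
    unfold SignedMeasure.totalVariation
    infer_instance
  simp [prod]

theorem eq_prod_of_rectangle {n : ℕ} {S T : Type*} [MeasurableSpace S] [MeasurableSpace T]
    (α : SignedVecMeasure n S) (β : SignedVecMeasure n T) (ω : SignedVecMeasure n (S × T))
    (h : ∀ (i : Fin n) (A : Set S) (B : Set T), MeasurableSet A → MeasurableSet B →
      ω i (A ×ˢ B) = α i A * β i B) :
    ω = α.prod β := by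
  funext i
  exact (VectorMeasure.prod_eq_of_forall_apply_prod (fun A B hA hB => h i A B hA hB)).symm

theorem skeleton_nonempty {n : ℕ} {S : Type*} [MeasurableSpace S] (α : SignedVecMeasure n S) :
    α.skeleton.Nonempty :=
  ⟨_, ∅, MeasurableSet.empty, rfl⟩

theorem skeleton_isBounded {n : ℕ} {S : Type*} [MeasurableSpace S] (α : SignedVecMeasure n S) :
    Bornology.IsBounded α.skeleton := by
  refine isBounded_iff_forall_norm_le.2 ⟨∑ i, ((α i).bound : ℝ), ?_⟩
  rintro _ ⟨A, _, rfl⟩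
  rw [PiLp.norm_eq_of_L1]
  exact Finset.sum_le_sum fun i _ => VectorMeasure.norm_apply_le_bound

/-- Skeletons are nonempty and bounded, so the real-valued Hausdorff distance between two
skeletons is the genuine (finite) one. -/
theorem hausdorffEDist_skeleton_ne_top {n : ℕ} {S T : Type*} [MeasurableSpace S]
    [MeasurableSpace T] (α : SignedVecMeasure n S) (β : SignedVecMeasure n T) :
    Metric.hausdorffEDist α.skeleton β.skeleton ≠ ⊤ :=
  Metric.hausdorffEDist_ne_top_of_nonempty_of_bounded α.skeleton_nonempty β.skeleton_nonempty
    α.skeleton_isBounded β.skeleton_isBounded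

end SignedVecMeasure

/-- The set of all Lorenz skeletons in `ℝⁿ`. -/
def LorenzSkeleton.{u} (n : ℕ) : Type :=
  {K : Set (RealVec n) //
    ∃ (S : Type u) (_ : MeasurableSpace S) (α : SignedVecMeasure n S), α.skeleton = K}

/-- The skeleton of a signed vector measure, as an element of the set of all skeletons. -/
def SignedVecMeasure.toLorenzSkeleton.{u} {n : ℕ} {S : Type u} [mS : MeasurableSpace S]
    (α : SignedVecMeasure n S) : LorenzSkeleton.{u} n :=
  ⟨α.skeleton, S, mS, α, rfl⟩

/-- A binary operation `P` on Lorenz skeletons is the Lorenz product when the product of the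
skeletons of `α` and `β` is the skeleton of `α × β`, for all `α` and `β`. -/
def IsLorenzProduct.{u} {n : ℕ}
    (P : LorenzSkeleton.{u} n → LorenzSkeleton.{u} n → LorenzSkeleton.{u} n) : Prop :=
  ∀ (S T : Type u) [MeasurableSpace S] [MeasurableSpace T]
    (α : SignedVecMeasure n S) (β : SignedVecMeasure n T),
    P α.toLorenzSkeleton β.toLorenzSkeleton = (α.prod β).toLorenzSkeleton

/-!
The value of `α × β` at a measurable set `A ⊆ S × T` is `∫ α(A_t) dβ(t)`, taken coordinatewise, where
`A_t` is the section of `A` at `t`. Only the points `α(A_t)` of the skeleton of `α` enter. If `A` has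
finitely many distinct sections, moving each `α(A_t)` to a point of the skeleton of `α'` at distance
less than `r` moves the value by at most `n * (r * (2 * C))`, where `C` bounds the skeleton of `β`.
Regions with finitely many measurable sections form an algebra generating the product `σ`-algebra, so
they approximate all measurable sets (`SignedVecMeasure.exists_sectionRegion_dist_lt`). Hence the
skeleton of `α × β` is a Lipschitz function of that of `α`, for the Hausdorff distance, with a constant
that depends only on a bound for the skeleton of `β`
(`SignedVecMeasure.hausdorffDist_prod_left_le`). As `α × β` and `β × α` have the same skeleton, joint
continuity follows from the triangle inequality.

Equal factors therefore give products whose skeletons are at Hausdorff distance `0`. To conclude that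
these are equal one needs that skeletons are closed, which is Lyapunov's theorem in the form that
allows atoms (`SignedVecMeasure.isCompact_skeleton`). The components of `α` have densities in `L²(μ)`
for the sum `μ` of their total variations. The functionals `⟪g, ·⟫` with `0 ≤ g ≤ 1` form a weak-*
compact set, and so do those for which, in addition, `g` is `0` or `1` almost everywhere on each atom
of `μ`. The values of the latter at the densities are a compact set containing the skeleton.
Conversely, the functionals of this kind with prescribed values and prescribed masses on atoms form a
compact convex set, which has an extreme point by the Krein–Milman lemma, and an extreme point is the
indicator of a measurable set: on a set where `0 < g < 1` there are no atoms, so it could be cut into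
`n + 1` parts of positive measure and `g` perturbed along a linear relation between their values.
-/

/-! ### Atoms -/

/-- An atom of `μ`: a measurable set of positive measure, every measurable part of which is
null or has full measure in it. -/
def IsMeasureAtom {S : Type*} [MeasurableSpace S] (μ : Measure S) (a : Set S) : Prop :=
  MeasurableSet a ∧ μ a ≠ 0 ∧ ∀ b ⊆ a, MeasurableSet b → μ b = 0 ∨ μ (a \ b) = 0

/-- A set of positive measure without atoms can be cut into any number of parts of positive
measure. -/
theorem exists_pairwise_disjoint_of_no_atom {S : Type*} [MeasurableSpace S] (μ : Measure S)
    (m : ℕ) : ∀ B : Set S, MeasurableSet B → μ B ≠ 0 → (∀ a ⊆ B, ¬ IsMeasureAtom μ a) →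
    ∃ s : Fin (m + 1) → Set S, (∀ j, MeasurableSet (s j)) ∧ (∀ j, s j ⊆ B) ∧
      (∀ j, μ (s j) ≠ 0) ∧ Pairwise (Function.onFun Disjoint s) := by
  induction m with
  | zero =>
    intro B hB h0 _
    exact ⟨fun _ => B, fun _ => hB, fun _ => subset_rfl, fun _ => h0,
      fun i j hij => (hij (by omega)).elim⟩
  | succ m ih =>
    intro B hB h0 hat
    have := hat B subset_rfl
    simp only [IsMeasureAtom, not_and, not_forall, not_or] at this
    obtain ⟨b, hbB, hb, hb0, hb1⟩ := this hB h0
    obtain ⟨s, hs, hsB, hs0, hd⟩ := ih (B \ b) (hB.diff hb) hb1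
      fun a ha => hat a (ha.trans Set.sdiff_subset)
    have hbs : ∀ j, Disjoint b (s j) := fun j =>
      Set.disjoint_sdiff_right.mono_right (hsB j)
    refine ⟨Fin.cons b s, Fin.cases hb hs, Fin.cases hbB fun j => (hsB j).trans Set.sdiff_subset,
      Fin.cases hb0 hs0, ?_⟩
    intro i j
    refine Fin.cases ?_ (fun i => ?_) i <;> refine Fin.cases ?_ (fun j => ?_) j
    · simp
    · intro _; simpa [Function.onFun] using hbs j
    · intro _; simpa [Function.onFun] using (hbs i).symm
    · intro h
      have : i ≠ j := fun e => h (by rw [e])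
      simpa [Function.onFun] using hd this

/-! ### Fractional sets -/

section Fractional

variable {S : Type*} [MeasurableSpace S] (μ : Measure S) [IsFiniteMeasure μ]

open scoped Classical in
/-- The indicator function of `B` as an element of `L²(μ)`, with value `0` if `B` is not
measurable. -/
noncomputable def indL2 (B : Set S) : Lp ℝ 2 μ :=
  if hB : MeasurableSet B then indicatorConstLp 2 hB (measure_ne_top μ B) 1 else 0

variable {μ}

theorem indL2_of_measurableSet {B : Set S} (hB : MeasurableSet B) :
    indL2 μ B = indicatorConstLp 2 hB (measure_ne_top μ B) 1 := dif_pos hB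

theorem indL2_coeFn {B : Set S} (hB : MeasurableSet B) :
    indL2 μ B =ᵐ[μ] B.indicator fun _ => (1 : ℝ) := by
  rw [indL2_of_measurableSet hB]
  exact indicatorConstLp_coeFn

theorem inner_indL2 {B : Set S} (hB : MeasurableSet B) (g : Lp ℝ 2 μ) :
    inner ℝ (indL2 μ B) g = ∫ s in B, g s ∂μ := by
  rw [indL2_of_measurableSet hB]
  exact L2.inner_indicatorConstLp_one hB _ g

theorem inner_indL2_indL2 {A B : Set S} (hA : MeasurableSet A) (hB : MeasurableSet B) :
    inner ℝ (indL2 μ A) (indL2 μ B) = μ.real (A ∩ B) := by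
  rw [indL2_of_measurableSet hB, indL2_of_measurableSet hA]
  exact L2.real_inner_indicatorConstLp_one_indicatorConstLp_one hA hB _ _

theorem indL2_union {A B : Set S} (hA : MeasurableSet A) (hB : MeasurableSet B)
    (h : Disjoint A B) : indL2 μ (A ∪ B) = indL2 μ A + indL2 μ B := by
  rw [indL2_of_measurableSet hB, indL2_of_measurableSet hA,
    indL2_of_measurableSet (hA.union hB)]
  exact indicatorConstLp_disjoint_union hA hB (measure_ne_top μ A) (measure_ne_top μ B) h 1

variable (μ)

/-- The fractional sets of `μ`: functionals `φ` on `L²(μ)` with `0 ≤ φ(1_B) ≤ μ(B)` for all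
measurable `B`. They are the functionals `⟪g, ·⟫` with `0 ≤ g ≤ 1`. -/
def fractionalSets : Set (WeakDual ℝ (Lp ℝ 2 μ)) :=
  {φ | ∀ B, MeasurableSet B → 0 ≤ φ (indL2 μ B) ∧ φ (indL2 μ B) ≤ μ.real B}

variable {μ}

theorem exists_density_of_mem_fractionalSets {φ : WeakDual ℝ (Lp ℝ 2 μ)}
    (hφ : φ ∈ fractionalSets μ) : ∃ g : Lp ℝ 2 μ, (∀ u, φ u = inner ℝ g u) ∧
      (0 ≤ᵐ[μ] g) ∧ (g ≤ᵐ[μ] fun _ => 1) := by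
  let g := (InnerProductSpace.toDual ℝ (Lp ℝ 2 μ)).symm (WeakDual.toStrongDual φ)
  have hg : ∀ u, φ u = inner ℝ g u := fun u => by
    rw [InnerProductSpace.toDual_symm_apply]; rfl
  have hint : Integrable g μ := (Lp.memLp g).integrable (by norm_num)
  have hB : ∀ B, MeasurableSet B → φ (indL2 μ B) = ∫ s in B, g s ∂μ := fun B hB => by
    rw [hg, real_inner_comm, inner_indL2 hB]
  refine ⟨g, hg, ?_, ?_⟩
  · refine ae_nonneg_of_forall_setIntegral_nonneg hint fun s hs _ => ?_
    rw [← hB s hs]; exact (hφ s hs).1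
  · refine ae_le_of_forall_setIntegral_le hint (integrable_const _) fun s hs _ => ?_
    rw [← hB s hs]; simpa using (hφ s hs).2

theorem isClosed_fractionalSets : IsClosed (fractionalSets μ) := by
  simp only [fractionalSets, Set.ofPred_forall, Set.ofPred_and]
  refine isClosed_iInter fun B => isClosed_iInter fun _ => ?_
  exact (isClosed_le continuous_const (WeakDual.eval_continuous _)).inter
    (isClosed_le (WeakDual.eval_continuous _) continuous_const)

theorem isCompact_fractionalSets : IsCompact (fractionalSets μ) := by
  refine (WeakDual.isCompact_closedBall (0 : StrongDual ℝ (Lp ℝ 2 μ))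
    ‖indL2 μ Set.univ‖).of_isClosed_subset isClosed_fractionalSets fun φ hφ => ?_
  obtain ⟨g, hg, h0, h1⟩ := exists_density_of_mem_fractionalSets hφ
  have e : WeakDual.toStrongDual φ = InnerProductSpace.toDual ℝ (Lp ℝ 2 μ) g := by
    ext u; exact hg u
  simp only [Set.mem_preimage, mem_closedBall_zero_iff]
  rw [e, LinearIsometryEquiv.norm_map]
  refine Lp.norm_le_norm_of_ae_le ?_
  filter_upwards [h0, h1, indL2_coeFn (μ := μ) MeasurableSet.univ] with s h0 h1 h
  rw [h]
  simpa [abs_of_nonneg (show 0 ≤ g s from h0)] using h1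

theorem map_indL2_union (φ : WeakDual ℝ (Lp ℝ 2 μ)) {A B : Set S} (hA : MeasurableSet A)
    (hB : MeasurableSet B) (h : Disjoint A B) :
    φ (indL2 μ (A ∪ B)) = φ (indL2 μ A) + φ (indL2 μ B) := by
  rw [indL2_union hA hB h, map_add]

theorem map_indL2_inter_add_diff (φ : WeakDual ℝ (Lp ℝ 2 μ)) {A B : Set S}
    (hA : MeasurableSet A) (hB : MeasurableSet B) :
    φ (indL2 μ (A ∩ B)) + φ (indL2 μ (A \ B)) = φ (indL2 μ A) := by
  rw [← map_indL2_union φ (hA.inter hB) (hA.diff hB)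
    (Set.disjoint_sdiff_inter.symm), Set.inter_union_sdiff]

/-! ### Extreme fractional sets -/

variable {n : ℕ}

variable (μ)

/-- The fractional sets with prescribed masses `t a` on the atoms `a` of `μ` and prescribed values
`x i` on the functions `f i`. -/
def fractionalFiber (t : Set S → ℝ) (f : Fin n → Lp ℝ 2 μ) (x : Fin n → ℝ) :
    Set (WeakDual ℝ (Lp ℝ 2 μ)) :=
  {φ | φ ∈ fractionalSets μ ∧ (∀ a, IsMeasureAtom μ a → φ (indL2 μ a) = t a) ∧
    ∀ i, φ (f i) = x i}

variable {μ}

theorem isCompact_fractionalFiber (t : Set S → ℝ) (f : Fin n → Lp ℝ 2 μ) (x : Fin n → ℝ) :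
    IsCompact (fractionalFiber μ t f x) := by
  refine isCompact_fractionalSets.inter_right (t := {φ : WeakDual ℝ (Lp ℝ 2 μ) |
    (∀ a, IsMeasureAtom μ a → φ (indL2 μ a) = t a) ∧ ∀ i, φ (f i) = x i}) ?_
  simp only [Set.ofPred_forall, Set.ofPred_and]
  exact (isClosed_iInter fun a => isClosed_iInter fun _ =>
      isClosed_eq (WeakDual.eval_continuous _) continuous_const).inter
    (isClosed_iInter fun i => isClosed_eq (WeakDual.eval_continuous _) continuous_const)

/-- If the density of `φ` stays between `ε` and `1 - ε` on `B`, then `B` is almost disjoint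
from every atom to which `φ` gives either no mass or the full mass: otherwise `B` would fill that atom
up to a null set. -/
theorem measure_inter_atom_eq_zero_of_fractional {φ : WeakDual ℝ (Lp ℝ 2 μ)}
    (hφ : φ ∈ fractionalSets μ) {B : Set S} {ε : ℝ} (hε : 0 < ε)
    (hB : ∀ D ⊆ B, MeasurableSet D → ε * μ.real D ≤ φ (indL2 μ D) ∧
      φ (indL2 μ D) ≤ (1 - ε) * μ.real D) {a : Set S} (ha : IsMeasureAtom μ a)
    (hφa : φ (indL2 μ a) = 0 ∨ φ (indL2 μ a) = μ.real a)
    {b : Set S} (hb : MeasurableSet b) (hbB : b ⊆ B) : μ (b ∩ a) = 0 := by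
  obtain ⟨ham, ha0, hat⟩ := ha
  refine (hat (b ∩ a) Set.inter_subset_right (hb.inter ham)).resolve_right fun h => ?_
  have hba := hb.inter ham
  have hsub : b ∩ a ⊆ a := Set.inter_subset_right
  have h1 := map_indL2_inter_add_diff φ ham hba
  rw [Set.inter_eq_right.2 hsub] at h1
  have h2 := hφ _ (ham.diff hba)
  have h3 : μ.real (a \ (b ∩ a)) = 0 := by rw [measureReal_def, h, ENNReal.toReal_zero]
  have h4 : μ.real a = μ.real (b ∩ a) := by
    have := measureReal_inter_add_sdiff (μ := μ) (s := a) hba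
    rw [Set.inter_eq_right.2 hsub] at this
    linarith
  have h5 := hB _ (Set.inter_subset_left.trans hbB) hba
  have h6 : 0 < μ.real a := ENNReal.toReal_pos ha0 (measure_ne_top _ _)
  rw [← h4] at h5
  rw [h3] at h2
  have := mul_pos hε h6
  rcases hφa with e | e <;> nlinarith

/-- `n + 1` vectors in `ℝⁿ` are linearly dependent, with coefficients as small as desired. -/
theorem exists_ne_zero_sum_smul_eq_zero (n : ℕ) (v : Fin (n + 1) → Fin n → ℝ) {ε : ℝ}
    (hε : 0 < ε) : ∃ c : Fin (n + 1) → ℝ, c ≠ 0 ∧ (∀ j, |c j| ≤ ε) ∧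
      ∀ i, ∑ j, c j * v j i = 0 := by
  have hker := LinearMap.ker_ne_bot_of_finrank_lt
    (f := Fintype.linearCombination ℝ v) (by simp)
  obtain ⟨c, hc, hc0⟩ := Submodule.exists_mem_ne_zero_of_ne_bot hker
  have hn : 0 < ‖c‖ := norm_pos_iff.2 hc0
  refine ⟨(ε / ‖c‖) • c, smul_ne_zero (div_pos hε hn).ne' hc0, fun j => ?_, fun i => ?_⟩
  · have := norm_le_pi_norm ((ε / ‖c‖) • c) j
    rwa [norm_smul, Real.norm_of_nonneg (div_pos hε hn).le, div_mul_cancel₀ _ hn.ne'] at this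
  · have h := congrFun (LinearMap.mem_ker.1 hc) i
    simp only [Fintype.linearCombination_apply, Finset.sum_apply, Pi.smul_apply, smul_eq_mul,
      Pi.zero_apply] at h
    simp only [Pi.smul_apply, smul_eq_mul, mul_assoc]
    rw [← Finset.mul_sum, h, mul_zero]

/-- The density of an extreme point of a fibre is nowhere strictly between `0` and `1`: on a set of
positive measure where it is, there are `n + 1` disjoint parts of positive measure, and a small
combination of their indicators that does not change the `n` prescribed values can be added to and
subtracted from it. -/
theorem measure_eq_zero_of_mem_extremePoints {t : Set S → ℝ}
    (ht : ∀ a, IsMeasureAtom μ a → t a = 0 ∨ t a = μ.real a) {f : Fin n → Lp ℝ 2 μ}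
    {x : Fin n → ℝ} {φ : WeakDual ℝ (Lp ℝ 2 μ)}
    (hφ : φ ∈ (fractionalFiber μ t f x).extremePoints ℝ) {B : Set S} (hBm : MeasurableSet B)
    {ε : ℝ} (hε : 0 < ε)
    (hB : ∀ D ⊆ B, MeasurableSet D → ε * μ.real D ≤ φ (indL2 μ D) ∧
      φ (indL2 μ D) ≤ (1 - ε) * μ.real D) : μ B = 0 := by
  by_contra hB0
  obtain ⟨hfr, hat, hval⟩ := hφ.1
  have hatom : ∀ a, IsMeasureAtom μ a → ∀ b, MeasurableSet b → b ⊆ B → μ (b ∩ a) = 0 :=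
    fun a ha b hb hbB => measure_inter_atom_eq_zero_of_fractional hfr hε hB ha
      (by rw [hat a ha]; exact ht a ha) hb hbB
  obtain ⟨s, hs, hsB, hs0, hd⟩ := exists_pairwise_disjoint_of_no_atom μ n B hBm hB0
    fun a haB ha => ha.2.1 (by simpa using hatom a ha a ha.1 haB)
  obtain ⟨c, hc0, hcε, hc⟩ := exists_ne_zero_sum_smul_eq_zero n
    (fun j i => inner ℝ (indL2 μ (s j)) (f i)) hε
  let ψ : WeakDual ℝ (Lp ℝ 2 μ) := StrongDual.toWeakDual
    (InnerProductSpace.toDual ℝ (Lp ℝ 2 μ) (∑ j, c j • indL2 μ (s j)))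
  have hψ : ∀ u, ψ u = ∑ j, c j * inner ℝ (indL2 μ (s j)) u := fun u => by
    change inner ℝ (∑ j, c j • indL2 μ (s j)) u = _
    simp [sum_inner, inner_smul_left]
  have hψD : ∀ D, MeasurableSet D → ψ (indL2 μ D) = ∑ j, c j * μ.real (s j ∩ D) :=
    fun D hD => by simp only [hψ, inner_indL2_indL2 (hs _) hD]
  -- the perturbation by `ψ` is dominated on `B` by the distance of `φ` to the constraints
  have hψle : ∀ D, MeasurableSet D → |ψ (indL2 μ D)| ≤ φ (indL2 μ D) ∧
      |ψ (indL2 μ D)| ≤ μ.real D - φ (indL2 μ D) := by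
    intro D hD
    have hU : MeasurableSet (⋃ j, s j) := MeasurableSet.iUnion hs
    have h1 : |ψ (indL2 μ D)| ≤ ε * μ.real (D ∩ ⋃ j, s j) := by
      have e : μ.real (D ∩ ⋃ j, s j) = ∑ j, μ.real (s j ∩ D) := by
        rw [Set.inter_comm, Set.iUnion_inter, measureReal_iUnion_fintype]
        · exact fun i j hij => (hd hij).mono Set.inter_subset_left Set.inter_subset_left
        · exact fun j => (hs j).inter hD
      rw [hψD D hD, e, Finset.mul_sum]
      refine (Finset.abs_sum_le_sum_abs _ _).trans (Finset.sum_le_sum fun j _ => ?_)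
      rw [abs_mul, abs_of_nonneg (measureReal_nonneg (μ := μ))]
      exact mul_le_mul_of_nonneg_right (hcε j) measureReal_nonneg
    have h2 := hB (D ∩ ⋃ j, s j) (Set.inter_subset_right.trans (Set.iUnion_subset hsB))
      (hD.inter hU)
    have h3 := hfr (D \ ⋃ j, s j) (hD.diff hU)
    have h4 := map_indL2_inter_add_diff φ hD hU
    have h5 := measureReal_inter_add_sdiff (μ := μ) (s := D) hU
    constructor <;> linarith
  have hmem : ∀ r : ℝ, |r| = 1 → φ + r • ψ ∈ fractionalFiber μ t f x := by
    intro r hr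
    have happ : ∀ u, (φ + r • ψ) u = φ u + r * ψ u := fun u => rfl
    refine ⟨fun D hD => ?_, fun a ha => ?_, fun i => ?_⟩
    · have h := hψle D hD
      have h' : |r * ψ (indL2 μ D)| = |ψ (indL2 μ D)| := by rw [abs_mul, hr, one_mul]
      rw [← h'] at h
      rw [happ]
      constructor
      · linarith [neg_abs_le (r * ψ (indL2 μ D)), h.1]
      · linarith [le_abs_self (r * ψ (indL2 μ D)), h.2]
    · have h0 : ψ (indL2 μ a) = 0 := by
        rw [hψD a ha.1]
        refine Finset.sum_eq_zero fun j _ => ?_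
        simp [measureReal_def, hatom a ha (s j) (hs j) (hsB j)]
      rw [happ, h0, mul_zero, add_zero, hat a ha]
    · rw [happ, hψ, hc i, mul_zero, add_zero, hval i]
  have key := (mem_extremePoints.1 hφ).2 _ (hmem 1 (by simp)) _ (hmem (-1) (by simp)) (by
    refine ⟨1 / 2, 1 / 2, by norm_num, by norm_num, by norm_num, ?_⟩
    module)
  have hψ0 : ψ = 0 := by simpa using key.1
  refine hc0 (funext fun k => ?_)
  have h := hψD (s k) (hs k)
  rw [Finset.sum_eq_single k, hψ0] at h
  · have hk : μ.real (s k ∩ s k) ≠ 0 := by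
      rw [Set.inter_self]
      exact (ENNReal.toReal_pos (hs0 k) (measure_ne_top _ _)).ne'
    exact (mul_eq_zero.1 h.symm).resolve_right hk
  · intro j _ hjk
    rw [(hd hjk).inter_eq]; simp
  · simp

/-- Extreme points of the fibres are indicators of measurable sets. -/
theorem exists_indL2_of_mem_extremePoints {t : Set S → ℝ}
    (ht : ∀ a, IsMeasureAtom μ a → t a = 0 ∨ t a = μ.real a) {f : Fin n → Lp ℝ 2 μ}
    {x : Fin n → ℝ} {φ : WeakDual ℝ (Lp ℝ 2 μ)}
    (hφ : φ ∈ (fractionalFiber μ t f x).extremePoints ℝ) :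
    ∃ A, MeasurableSet A ∧ ∀ u, φ u = inner ℝ (indL2 μ A) u := by
  obtain ⟨g, hg, h0, h1⟩ := exists_density_of_mem_fractionalSets hφ.1.1
  have hgm : Measurable g := (Lp.stronglyMeasurable g).measurable
  have hint : Integrable g μ := (Lp.memLp g).integrable (by norm_num)
  have hnull : ∀ ε : ℝ, 0 < ε → μ {s | ε ≤ g s ∧ g s ≤ 1 - ε} = 0 := by
    intro ε hε
    have hm : MeasurableSet {s | ε ≤ g s ∧ g s ≤ 1 - ε} :=
      (measurableSet_le measurable_const hgm).inter (measurableSet_le hgm measurable_const)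
    refine measure_eq_zero_of_mem_extremePoints ht hφ hm hε fun D hD hDm => ?_
    rw [hg, real_inner_comm, inner_indL2 hDm]
    constructor
    · have := setIntegral_mono_on (integrableOn_const (μ := μ) (s := D) (C := ε)) hint.integrableOn
        hDm fun s hs => (hD hs).1
      simpa [mul_comm] using this
    · have := setIntegral_mono_on hint.integrableOn
        (integrableOn_const (μ := μ) (s := D) (C := 1 - ε)) hDm fun s hs => (hD hs).2
      simpa [mul_comm] using this
  have hall : ∀ᵐ s ∂μ, ∀ k : ℕ, ¬ (1 / ((k : ℝ) + 1) ≤ g s ∧ g s ≤ 1 - 1 / ((k : ℝ) + 1)) :=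
    ae_all_iff.2 fun k => by
      rw [ae_iff]; simpa only [not_not] using hnull _ Nat.one_div_pos_of_nat
  have hA : MeasurableSet {s | 1 / 2 ≤ g s} := measurableSet_le measurable_const hgm
  refine ⟨{s | 1 / 2 ≤ g s}, hA, fun u => ?_⟩
  rw [hg]
  congr 1
  refine Lp.ext ?_
  filter_upwards [h0, h1, hall, indL2_coeFn (μ := μ) hA] with s h0 h1 h he
  rw [he]
  have h0' : 0 ≤ g s := h0
  by_cases hs : 1 / 2 ≤ g s
  · rw [Set.indicator_of_mem (show s ∈ {s | 1 / 2 ≤ g s} from hs)]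
    by_contra hne
    obtain ⟨k, hk⟩ := exists_nat_one_div_lt (sub_pos.2 (lt_of_le_of_ne h1 hne))
    have hk' : 1 / ((k : ℝ) + 1 + 1) ≤ 1 / ((k : ℝ) + 1) :=
      one_div_le_one_div_of_le (by positivity) (by linarith)
    have hk2 : 1 / ((k : ℝ) + 1 + 1) ≤ 1 / 2 :=
      one_div_le_one_div_of_le (by norm_num) (by linarith [(Nat.cast_nonneg k : (0 : ℝ) ≤ k)])
    -- passing to `k + 1` makes the threshold at most `1 / 2`, for the bound on the other side
    exact h (k + 1) ⟨by push_cast; linarith, by push_cast; linarith⟩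
  · rw [Set.indicator_of_notMem (show s ∉ {s | 1 / 2 ≤ g s} from hs)]
    by_contra hne
    obtain ⟨k, hk⟩ := exists_nat_one_div_lt (lt_of_le_of_ne h0' (Ne.symm hne))
    have hk' : 1 / ((k : ℝ) + 1 + 1) ≤ 1 / ((k : ℝ) + 1) :=
      one_div_le_one_div_of_le (by positivity) (by linarith)
    have hk2 : 1 / ((k : ℝ) + 1 + 1) ≤ 1 / 2 :=
      one_div_le_one_div_of_le (by norm_num) (by linarith [(Nat.cast_nonneg k : (0 : ℝ) ≤ k)])
    exact h (k + 1) ⟨by push_cast; linarith, by push_cast; linarith⟩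

end Fractional

/-! ### Compactness of skeletons -/

theorem exists_indL2_density_of_le {S : Type*} [MeasurableSpace S] {ν μ : Measure S}
    [IsFiniteMeasure μ] (h : ν ≤ μ) :
    ∃ f : Lp ℝ 2 μ, ∀ A, MeasurableSet A → ν.real A = inner ℝ (indL2 μ A) f := by
  have : IsFiniteMeasure ν := ⟨(h Set.univ).trans_lt (measure_lt_top _ _)⟩
  have hmem : MemLp (fun s => (ν.rnDeriv μ s).toReal) 2 μ := by
    refine MemLp.of_bound (Measure.measurable_rnDeriv ν μ).ennreal_toReal.aestronglyMeasurable 1 ?_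
    filter_upwards [Measure.rnDeriv_le_one_of_le h] with s hs
    simpa using ENNReal.toReal_mono ENNReal.one_ne_top hs
  refine ⟨hmem.toLp, fun A hA => ?_⟩
  rw [inner_indL2 hA, setIntegral_congr_ae hA (hmem.coeFn_toLp.mono fun s h _ => h),
    Measure.setIntegral_toReal_rnDeriv (Measure.absolutelyContinuous_of_le h)]

instance {S : Type*} [MeasurableSpace S] (ω : SignedMeasure S) :
    IsFiniteMeasure ω.totalVariation := by
  unfold SignedMeasure.totalVariation; infer_instance

namespace SignedVecMeasure

/-- The sum of the total variations of the components. -/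
noncomputable def control {n : ℕ} {S : Type*} [MeasurableSpace S] (α : SignedVecMeasure n S) :
    Measure S :=
  ∑ i, (α i).totalVariation

instance {n : ℕ} {S : Type*} [MeasurableSpace S] (α : SignedVecMeasure n S) :
    IsFiniteMeasure α.control := by
  unfold control; infer_instance

theorem totalVariation_le_control {n : ℕ} {S : Type*} [MeasurableSpace S]
    (α : SignedVecMeasure n S) (i : Fin n) : (α i).totalVariation ≤ α.control := by
  intro A
  rw [control, Measure.finsetSum_apply]
  exact Finset.single_le_sum (f := fun i => (α i).totalVariation A) (fun _ _ => zero_le)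
    (Finset.mem_univ i)

theorem exists_density {n : ℕ} {S : Type*} [MeasurableSpace S] (α : SignedVecMeasure n S)
    (i : Fin n) : ∃ f : Lp ℝ 2 α.control, ∀ A, MeasurableSet A →
      α i A = inner ℝ (indL2 α.control A) f := by
  have h := α.totalVariation_le_control i
  obtain ⟨p, hp⟩ := exists_indL2_density_of_le ((Measure.le_add_right le_rfl).trans h :
    (α i).toJordanDecomposition.posPart ≤ α.control)
  obtain ⟨q, hq⟩ := exists_indL2_density_of_le ((Measure.le_add_left le_rfl).trans h :
    (α i).toJordanDecomposition.negPart ≤ α.control)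
  refine ⟨p - q, fun A hA => ?_⟩
  rw [inner_sub_right, ← hp A hA, ← hq A hA,
    SignedMeasure.apply_eq_posPart_real_sub_negPart_real _ hA]

/-- Lyapunov's compactness theorem, for measures that may have atoms. The skeleton is the image of
the weak-* compact set of fractional sets that are trivial on each atom: a point of that image has a
fibre with an extreme point, which is the indicator of a measurable set. -/
theorem isCompact_skeleton {n : ℕ} {S : Type*} [MeasurableSpace S] (α : SignedVecMeasure n S) :
    IsCompact α.skeleton := by
  choose f hf using α.exists_density
  let μ := α.control
  let K : Set (WeakDual ℝ (Lp ℝ 2 μ)) := {φ | φ ∈ fractionalSets μ ∧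
    ∀ a, IsMeasureAtom μ a → φ (indL2 μ a) = 0 ∨ φ (indL2 μ a) = μ.real a}
  have hK : IsCompact K := by
    refine isCompact_fractionalSets.inter_right (t := {φ : WeakDual ℝ (Lp ℝ 2 μ) |
      ∀ a, IsMeasureAtom μ a → φ (indL2 μ a) = 0 ∨ φ (indL2 μ a) = μ.real a}) ?_
    simp only [Set.ofPred_forall, Set.ofPred_or]
    exact isClosed_iInter fun a => isClosed_iInter fun _ =>
      (isClosed_eq (WeakDual.eval_continuous _) continuous_const).union
        (isClosed_eq (WeakDual.eval_continuous _) continuous_const)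
  let Φ : WeakDual ℝ (Lp ℝ 2 μ) → RealVec n := fun φ => WithLp.toLp 1 fun i => φ (f i)
  have hΦ : Continuous Φ := (PiLp.continuous_toLp 1 _).comp
    (continuous_pi fun i => WeakDual.eval_continuous _)
  suffices α.skeleton = Φ '' K by rw [this]; exact hK.image hΦ
  refine Set.Subset.antisymm ?_ ?_
  · rintro _ ⟨A, hA, rfl⟩
    refine ⟨StrongDual.toWeakDual (InnerProductSpace.toDual ℝ (Lp ℝ 2 μ) (indL2 μ A)),
      ⟨fun B hB => ?_, fun a ha => ?_⟩, ?_⟩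
    · change 0 ≤ inner ℝ (indL2 μ A) (indL2 μ B) ∧ inner ℝ (indL2 μ A) (indL2 μ B) ≤ _
      rw [inner_indL2_indL2 hA hB]
      exact ⟨measureReal_nonneg, measureReal_mono Set.inter_subset_right⟩
    · change inner ℝ (indL2 μ A) (indL2 μ a) = 0 ∨ inner ℝ (indL2 μ A) (indL2 μ a) = _
      rw [inner_indL2_indL2 hA ha.1]
      refine (ha.2.2 (A ∩ a) Set.inter_subset_right (hA.inter ha.1)).imp (fun h => ?_) fun h => ?_
      · simp [measureReal_def, h]
      · have e := measureReal_inter_add_sdiff (μ := μ) (s := a) (hA.inter ha.1)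
        rw [Set.inter_eq_right.2 Set.inter_subset_right, measureReal_def μ (a \ (A ∩ a)), h] at e
        simpa using e
    · exact congrArg (WithLp.toLp 1) (funext fun i => (hf i A hA).symm)
  · rintro _ ⟨φ₀, ⟨hφ₀, hat⟩, rfl⟩
    have : LocallyConvexSpace ℝ (WeakDual ℝ (Lp ℝ 2 μ)) :=
      inferInstanceAs (LocallyConvexSpace ℝ (WeakBilin (topDualPairing ℝ (Lp ℝ 2 μ))))
    obtain ⟨φ, hφ⟩ := (isCompact_fractionalFiber (fun a => φ₀ (indL2 μ a)) f
      fun i => φ₀ (f i)).extremePoints_nonempty ⟨φ₀, hφ₀, fun _ _ => rfl, fun _ => rfl⟩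
    obtain ⟨A, hA, h⟩ := exists_indL2_of_mem_extremePoints hat hφ
    refine ⟨A, hA, congrArg (WithLp.toLp 1) (funext fun i => ?_)⟩
    rw [hf i A hA, ← h, hφ.1.2.2 i]

end SignedVecMeasure

/-! ### Approximation by finite unions of rectangles -/

/-- The region `{(s, t) | s ∈ F t}` in `S × T` with sections `F t`. For a simple function `F` with
measurable values it is a finite union of measurable rectangles over disjoint bases in `T`. -/
def sectionRegion {S T : Type*} [MeasurableSpace T] (F : SimpleFunc T (Set S)) : Set (S × T) :=
  {p | p.1 ∈ F p.2}

theorem sectionRegion_map {S T U : Type*} [MeasurableSpace T] (F : SimpleFunc T U)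
    (G : U → Set S) : sectionRegion (F.map G) = ⋃ u ∈ F.range, G u ×ˢ (F ⁻¹' {u}) := by
  ext p
  simp only [sectionRegion, SimpleFunc.map_apply, Set.mem_ofPred_eq, SimpleFunc.mem_range,
    Set.mem_iUnion, Set.mem_prod, Set.mem_preimage, Set.mem_singleton_iff]
  constructor
  · exact fun h => ⟨_, ⟨p.2, rfl⟩, h, rfl⟩
  · rintro ⟨_, _, h, rfl⟩
    exact h

theorem measurableSet_sectionRegion {S T : Type*} [MeasurableSpace S] [MeasurableSpace T]
    {F : SimpleFunc T (Set S)} (hF : ∀ t, MeasurableSet (F t)) :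
    MeasurableSet (sectionRegion F) := by
  rw [show F = F.map id from rfl, sectionRegion_map]
  refine Finset.measurableSet_biUnion _ fun A hA => ?_
  obtain ⟨t, rfl⟩ := SimpleFunc.mem_range.1 hA
  exact (hF t).prod (F.measurableSet_fiber _)

/-- The regions with finitely many measurable sections. -/
def sectionRegions (S T : Type*) [MeasurableSpace S] [MeasurableSpace T] : Set (Set (S × T)) :=
  {R | ∃ F : SimpleFunc T (Set S), (∀ t, MeasurableSet (F t)) ∧ sectionRegion F = R}

theorem isSetAlgebra_sectionRegions (S T : Type*) [MeasurableSpace S] [MeasurableSpace T] :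
    IsSetAlgebra (sectionRegions S T) where
  empty_mem := ⟨SimpleFunc.const T ∅, fun _ => MeasurableSet.empty, rfl⟩
  compl_mem := by
    rintro _ ⟨F, hF, rfl⟩
    exact ⟨F.map compl, fun t => (hF t).compl, rfl⟩
  union_mem := by
    rintro _ _ ⟨F, hF, rfl⟩ ⟨G, hG, rfl⟩
    exact ⟨(F.pair G).map fun p : Set S × Set S => p.1 ∪ p.2, fun t => (hF t).union (hG t), rfl⟩

theorem generateFrom_sectionRegions (S T : Type*) [MeasurableSpace S] [MeasurableSpace T] :
    (inferInstance : MeasurableSpace (S × T)) =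
      MeasurableSpace.generateFrom (sectionRegions S T) := by
  classical
  refine le_antisymm ?_ (MeasurableSpace.generateFrom_le ?_)
  · rw [show (inferInstance : MeasurableSpace (S × T)) = _ from generateFrom_prod.symm]
    refine MeasurableSpace.generateFrom_mono ?_
    rintro _ ⟨A, hA, B, hB, rfl⟩
    refine ⟨SimpleFunc.piecewise B hB (SimpleFunc.const T A) (SimpleFunc.const T ∅), fun t => ?_, ?_⟩
    · by_cases h : t ∈ B <;> simp_all
    · ext p
      by_cases h : p.2 ∈ B <;> simp [sectionRegion, h]
  · rintro _ ⟨F, hF, rfl⟩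
    exact measurableSet_sectionRegion hF

theorem abs_apply_sub_apply_le {S : Type*} [MeasurableSpace S] (ω : SignedMeasure S) {A R : Set S}
    (hA : MeasurableSet A) (hR : MeasurableSet R) :
    |ω A - ω R| ≤ ω.totalVariation.real (symmDiff A R) := by
  have hle : ∀ D, MeasurableSet D → |ω D| ≤ ω.totalVariation.real D := fun D hD => by
    rw [SignedMeasure.apply_eq_posPart_real_sub_negPart_real _ hD, SignedMeasure.totalVariation,
      measureReal_add_apply]
    refine (abs_sub _ _).trans ?_
    rw [abs_of_nonneg measureReal_nonneg, abs_of_nonneg measureReal_nonneg]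
  have h1 := VectorMeasure.of_union (v := ω)
    (Set.disjoint_sdiff_inter.symm : Disjoint (A ∩ R) (A \ R)) (hA.inter hR) (hA.diff hR)
  have h2 := VectorMeasure.of_union (v := ω)
    (Set.disjoint_sdiff_inter.symm : Disjoint (R ∩ A) (R \ A)) (hR.inter hA) (hR.diff hA)
  rw [Set.inter_union_sdiff] at h1 h2
  rw [Set.inter_comm R A] at h2
  have h3 : ω A - ω R = ω (A \ R) - ω (R \ A) := by linarith
  rw [h3, Set.symmDiff_def, measureReal_union (disjoint_sdiff_sdiff) (hR.diff hA)]
  exact (abs_sub _ _).trans (add_le_add (hle _ (hA.diff hR)) (hle _ (hR.diff hA)))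

namespace SignedVecMeasure

theorem dist_eval_eval {n : ℕ} {S T : Type*} [MeasurableSpace S] [MeasurableSpace T]
    (α : SignedVecMeasure n S) (β : SignedVecMeasure n T) (A : Set S) (B : Set T) :
    dist (α.eval A) (β.eval B) = ∑ i, |α i A - β i B| := by
  rw [PiLp.dist_eq_of_L1]
  rfl

/-- The regions with finitely many measurable sections form an algebra generating the product
`σ`-algebra, so they are dense for the total variation of any vector measure on `S × T`. -/
theorem exists_sectionRegion_dist_lt {n : ℕ} {S T : Type*} [MeasurableSpace S]
    [MeasurableSpace T] (ω : SignedVecMeasure n (S × T)) {A : Set (S × T)} (hA : MeasurableSet A)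
    {η : ℝ} (hη : 0 < η) : ∃ F : SimpleFunc T (Set S), (∀ t, MeasurableSet (F t)) ∧
      dist (ω.eval A) (ω.eval (sectionRegion F)) < η := by
  have hdense := Measure.MeasureDense.of_generateFrom_isSetAlgebra_finite (μ := ω.control)
    (isSetAlgebra_sectionRegions S T) (generateFrom_sectionRegions S T)
  obtain ⟨_, ⟨F, hF, rfl⟩, hlt⟩ := hdense.approx A hA (measure_ne_top _ _) η hη
  have hR := measurableSet_sectionRegion hF
  refine ⟨F, hF, ?_⟩
  rw [dist_eval_eval]
  refine (Finset.sum_le_sum fun i _ => abs_apply_sub_apply_le (ω i) hA hR).trans_lt ?_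
  have e : ω.control.real (symmDiff A (sectionRegion F)) =
      ∑ i, (ω i).totalVariation.real (symmDiff A (sectionRegion F)) := by
    simp only [measureReal_def, control, Measure.finsetSum_apply]
    exact ENNReal.toReal_sum fun i _ => measure_ne_top _ _
  rw [← e, measureReal_def]
  exact (ENNReal.lt_ofReal_iff_toReal_lt (measure_ne_top _ _)).1 hlt

/-- The value of `α × β` at a region is the integral over `β` of the `α`-values of its sections. -/
theorem prod_apply_sectionRegion {n : ℕ} {S T U : Type*} [MeasurableSpace S] [MeasurableSpace T]
    (α : SignedVecMeasure n S) (β : SignedVecMeasure n T) (F : SimpleFunc T U) (G : U → Set S)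
    (hG : ∀ u, MeasurableSet (G u)) (i : Fin n) :
    α.prod β i (sectionRegion (F.map G)) = ∑ u ∈ F.range, α i (G u) * β i (F ⁻¹' {u}) := by
  rw [sectionRegion_map, VectorMeasure.of_biUnion_finset]
  · simp only [prod_rectangle]
  · intro u _ v _ huv
    refine Set.disjoint_left.2 fun p hp hq => huv ?_
    exact (show F p.2 = u from hp.2).symm.trans hq.2
  · exact fun u _ => (hG u).prod (F.measurableSet_fiber u)

/-- The variation of `βᵢ` over a finite partition is controlled by the skeleton of `β` alone, since
the parts on which `βᵢ` is positive, or negative, have a union whose value lies in the skeleton. -/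
theorem sum_abs_fiber_le {n : ℕ} {T U : Type*} [MeasurableSpace T]
    (β : SignedVecMeasure n T) {C : ℝ} (hC : ∀ x ∈ β.skeleton, ‖x‖ ≤ C)
    (F : SimpleFunc T U) (i : Fin n) : ∑ u ∈ F.range, |β i (F ⁻¹' {u})| ≤ 2 * C := by
  have hle : ∀ B, MeasurableSet B → |β i B| ≤ C := fun B hB =>
    (PiLp.norm_apply_le (β.eval B) i).trans (hC _ ⟨B, hB, rfl⟩)
  have hsum : ∀ s : Finset U, |∑ u ∈ s, β i (F ⁻¹' {u})| ≤ C := fun s => by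
    rw [← VectorMeasure.of_biUnion_finset]
    · exact hle _ (Finset.measurableSet_biUnion _ fun u _ => F.measurableSet_fiber u)
    · intro u _ v _ huv
      exact Set.disjoint_left.2 fun p hp hq => huv ((show F p = u from hp).symm.trans hq)
    · exact fun u _ => F.measurableSet_fiber u
  classical
  rw [← Finset.sum_filter_add_sum_filter_not _ (fun u => 0 ≤ β i (F ⁻¹' {u})), two_mul]
  refine add_le_add ?_ ?_
  · rw [Finset.sum_congr rfl fun u hu => abs_of_nonneg (Finset.mem_filter.1 hu).2]
    exact (le_abs_self _).trans (hsum _)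
  · rw [Finset.sum_congr rfl fun u hu => abs_of_nonpos (not_le.1 (Finset.mem_filter.1 hu).2).le,
      Finset.sum_neg_distrib]
    exact (neg_le_abs _).trans (hsum _)

/-! ### Dependence of the product on its factors -/

theorem exists_dist_le_of_hausdorffDist_lt {n : ℕ} {S S' T : Type*} [MeasurableSpace S]
    [MeasurableSpace S'] [MeasurableSpace T] (α : SignedVecMeasure n S)
    (α' : SignedVecMeasure n S') (β : SignedVecMeasure n T) {C : ℝ}
    (hC : ∀ x ∈ β.skeleton, ‖x‖ ≤ C) {r : ℝ}
    (hr : Metric.hausdorffDist α.skeleton α'.skeleton < r) {x : RealVec n}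
    (hx : x ∈ (α.prod β).skeleton) {η : ℝ} (hη : 0 < η) :
    ∃ y ∈ (α'.prod β).skeleton, dist x y ≤ n * (r * (2 * C)) + η := by
  obtain ⟨A, hA, rfl⟩ := hx
  obtain ⟨F, hF, hlt⟩ := exists_sectionRegion_dist_lt (α.prod β) hA hη
  have hr0 : 0 < r := Metric.hausdorffDist_nonneg.trans_lt hr
  classical
  -- every value of `F` is replaced by a measurable set of nearly the same `α'`-value
  let G : Set S → Set S := fun B => if MeasurableSet B then B else ∅
  have hG : ∀ B, MeasurableSet (G B) := fun B => by
    by_cases h : MeasurableSet B <;> simp [G, h]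
  have hFG : F.map G = F := SimpleFunc.ext fun t => by simp [G, hF t]
  have hex : ∀ B, ∃ B' : Set S', MeasurableSet B' ∧ dist (α.eval (G B)) (α'.eval B') < r := by
    intro B
    obtain ⟨_, ⟨B', hB', rfl⟩, h⟩ := Metric.exists_dist_lt_of_hausdorffDist_lt
      (show α.eval (G B) ∈ α.skeleton from ⟨_, hG B, rfl⟩) hr
      (hausdorffEDist_skeleton_ne_top α α')
    exact ⟨B', hB', h⟩
  choose G' hG' hd using hex
  refine ⟨_, ⟨sectionRegion (F.map G'), measurableSet_sectionRegion fun t => hG' _, rfl⟩, ?_⟩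
  refine (dist_triangle _ _ _).trans ((add_le_add hlt.le ?_).trans_eq (add_comm _ _))
  rw [dist_eval_eval]
  nth_rewrite 1 [← hFG]
  have hi : ∀ i, |α.prod β i (sectionRegion (F.map G)) - α'.prod β i (sectionRegion (F.map G'))|
      ≤ r * (2 * C) := by
    intro i
    rw [prod_apply_sectionRegion α β F G hG, prod_apply_sectionRegion α' β F G' hG',
      ← Finset.sum_sub_distrib]
    refine (Finset.abs_sum_le_sum_abs _ _).trans ?_
    refine le_trans (Finset.sum_le_sum fun u _ => ?_)
      ((Finset.mul_sum _ _ r).symm.trans_le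
        (mul_le_mul_of_nonneg_left (sum_abs_fiber_le β hC F i) hr0.le))
    rw [← sub_mul, abs_mul]
    refine mul_le_mul_of_nonneg_right ?_ (abs_nonneg _)
    exact (PiLp.norm_apply_le (α.eval (G u) - α'.eval (G' u)) i).trans
      ((dist_eq_norm _ _).symm.trans_le (hd u).le)
  refine (Finset.sum_le_sum fun i _ => hi i).trans (le_of_eq ?_)
  simp

/-- With `β` fixed, the skeleton of `α × β` is a Lipschitz function of the skeleton of `α`. -/
theorem hausdorffDist_prod_left_le {n : ℕ} {S S' T : Type*} [MeasurableSpace S]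
    [MeasurableSpace S'] [MeasurableSpace T] (α : SignedVecMeasure n S)
    (α' : SignedVecMeasure n S') (β : SignedVecMeasure n T) {C : ℝ}
    (hC : ∀ x ∈ β.skeleton, ‖x‖ ≤ C) {r : ℝ}
    (hr : Metric.hausdorffDist α.skeleton α'.skeleton < r) :
    Metric.hausdorffDist (α.prod β).skeleton (α'.prod β).skeleton ≤ n * (r * (2 * C)) := by
  have hr0 : 0 < r := Metric.hausdorffDist_nonneg.trans_lt hr
  have hC0 : 0 ≤ C := by
    obtain ⟨x, hx⟩ := β.skeleton_nonempty
    exact (norm_nonneg x).trans (hC x hx)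
  refine le_of_forall_pos_le_add fun η hη => ?_
  refine Metric.hausdorffDist_le_of_mem_dist (by positivity) (fun x hx => ?_) fun x hx => ?_
  · exact exists_dist_le_of_hausdorffDist_lt α α' β hC hr hx hη
  · exact exists_dist_le_of_hausdorffDist_lt α' α β hC
      (by rwa [Metric.hausdorffDist_comm]) hx hη

theorem skeleton_prod_swap_subset {n : ℕ} {S T : Type*} [MeasurableSpace S] [MeasurableSpace T]
    (α : SignedVecMeasure n S) (β : SignedVecMeasure n T) :
    (α.prod β).skeleton ⊆ (β.prod α).skeleton := by
  have h : (fun i => (α.prod β i).map Prod.swap) = β.prod α := by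
    refine eq_prod_of_rectangle β α _ fun i B A hB hA => ?_
    rw [VectorMeasure.map_apply _ measurable_swap (hB.prod hA), Set.preimage_swap_prod,
      prod_rectangle, mul_comm]
  rintro _ ⟨A, hA, rfl⟩
  refine ⟨Prod.swap ⁻¹' A, measurable_swap hA, congrArg (WithLp.toLp 1) (funext fun i => ?_)⟩
  rw [← h, VectorMeasure.map_apply _ measurable_swap (measurable_swap hA)]
  rfl

theorem skeleton_prod_comm {n : ℕ} {S T : Type*} [MeasurableSpace S] [MeasurableSpace T]
    (α : SignedVecMeasure n S) (β : SignedVecMeasure n T) :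
    (α.prod β).skeleton = (β.prod α).skeleton :=
  Set.Subset.antisymm (skeleton_prod_swap_subset α β) (skeleton_prod_swap_subset β α)

theorem exists_hausdorffDist_prod_lt {n : ℕ} {S : Type u₁} {T : Type v₁} [MeasurableSpace S]
    [MeasurableSpace T] (α : SignedVecMeasure n S) (β : SignedVecMeasure n T) {ε : ℝ}
    (hε : 0 < ε) : ∃ δ : ℝ, 0 < δ ∧
      ∀ (S' : Type u₂) (T' : Type v₂) [MeasurableSpace S'] [MeasurableSpace T']
        (α' : SignedVecMeasure n S') (β' : SignedVecMeasure n T'),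
        Metric.hausdorffDist α.skeleton α'.skeleton < δ →
        Metric.hausdorffDist β.skeleton β'.skeleton < δ →
        Metric.hausdorffDist (α.prod β).skeleton (α'.prod β').skeleton < ε := by
  obtain ⟨C, hC0, hC⟩ := α.skeleton_isBounded.exists_pos_norm_le
  obtain ⟨D, hD0, hD⟩ := β.skeleton_isBounded.exists_pos_norm_le
  let M : ℝ := n * (2 * D) + n * (2 * (C + 1)) + 1
  have hM : 0 < M := by positivity
  refine ⟨min 1 (ε / M), lt_min one_pos (div_pos hε hM), fun S' T' _ _ α' β' hα hβ => ?_⟩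
  -- `δ ≤ 1` makes the skeletons of all admissible `α'` uniformly bounded
  have hC' : ∀ x ∈ α'.skeleton, ‖x‖ ≤ C + 1 := fun x hx => by
    obtain ⟨y, hy, hyx⟩ := Metric.exists_dist_lt_of_hausdorffDist_lt' hx
      (hα.trans_le (min_le_left _ _)) (hausdorffEDist_skeleton_ne_top α α')
    rw [dist_comm, dist_eq_norm] at hyx
    linarith [norm_le_norm_add_norm_sub' x y, hC y hy]
  have h1 := hausdorffDist_prod_left_le α α' β hD (hα.trans_le (min_le_right _ _))
  have h2 := hausdorffDist_prod_left_le β β' α' hC' (hβ.trans_le (min_le_right _ _))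
  rw [skeleton_prod_comm β, skeleton_prod_comm β'] at h2
  have h3 := Metric.hausdorffDist_triangle (u := (α'.prod β').skeleton)
    (hausdorffEDist_skeleton_ne_top (α.prod β) (α'.prod β))
  have h4 : ε / M * M = ε := div_mul_cancel₀ _ hM.ne'
  have h5 : 0 < ε / M := div_pos hε hM
  simp only [M] at h4 h5 h1 h2
  nlinarith

theorem skeleton_prod_congr {n : ℕ} {S T S' T' : Type*} [MeasurableSpace S] [MeasurableSpace T]
    [MeasurableSpace S'] [MeasurableSpace T'] {α : SignedVecMeasure n S}
    {β : SignedVecMeasure n T} {α' : SignedVecMeasure n S'} {β' : SignedVecMeasure n T'}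
    (hα : α.skeleton = α'.skeleton) (hβ : β.skeleton = β'.skeleton) :
    (α.prod β).skeleton = (α'.prod β').skeleton := by
  refine (IsClosed.hausdorffDist_zero_iff_eq (isCompact_skeleton _).isClosed
    (isCompact_skeleton _).isClosed (hausdorffEDist_skeleton_ne_top _ _)).1 ?_
  refine le_antisymm (le_of_forall_pos_le_add fun ε hε => ?_) Metric.hausdorffDist_nonneg
  obtain ⟨δ, hδ, h⟩ := exists_hausdorffDist_prod_lt α β hε
  rw [zero_add]
  refine (h _ _ α' β' ?_ ?_).le
  · rwa [hα, Metric.hausdorffDist_self_zero]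
  · rwa [hβ, Metric.hausdorffDist_self_zero]

end SignedVecMeasure

theorem existsUnique_isLorenzProduct (n : ℕ) :
    ∃! P : LorenzSkeleton.{u₁} n → LorenzSkeleton.{u₁} n → LorenzSkeleton.{u₁} n,
      IsLorenzProduct P := by
  choose S mS α hα using fun K : LorenzSkeleton.{u₁} n => K.2
  refine ⟨fun K L => ((α K).prod (α L)).toLorenzSkeleton, fun S T _ _ β γ => ?_, fun Q hQ => ?_⟩
  · exact Subtype.ext (SignedVecMeasure.skeleton_prod_congr (hα β.toLorenzSkeleton)
      (hα γ.toLorenzSkeleton))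
  · funext K L
    have h := hQ (S K) (S L) (α K) (α L)
    rwa [show (α K).toLorenzSkeleton = K from Subtype.ext (hα K),
      show (α L).toLorenzSkeleton = L from Subtype.ext (hα L)] at h

theorem mainTheorem4 (n : ℕ) :
    -- continuity of the skeleton of a product in the skeletons of the factors
    (∀ (S : Type u₁) (T : Type v₁) [MeasurableSpace S] [MeasurableSpace T]
      (α : SignedVecMeasure n S) (β : SignedVecMeasure n T) (ε : ℝ), 0 < ε →
      ∃ δ : ℝ, 0 < δ ∧
        ∀ (S' : Type u₂) (T' : Type v₂) [MeasurableSpace S'] [MeasurableSpace T']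
          (α' : SignedVecMeasure n S') (β' : SignedVecMeasure n T'),
          Metric.hausdorffDist α.skeleton α'.skeleton < δ →
          Metric.hausdorffDist β.skeleton β'.skeleton < δ →
          Metric.hausdorffDist (α.prod β).skeleton (α'.prod β').skeleton < ε) ∧
    -- the skeleton of a product depends only on the skeletons of the factors
    (∀ (S : Type u₁) (T : Type v₁) (S' : Type u₂) (T' : Type v₂)
      [MeasurableSpace S] [MeasurableSpace T] [MeasurableSpace S'] [MeasurableSpace T']
      (α : SignedVecMeasure n S) (β : SignedVecMeasure n T)
      (α' : SignedVecMeasure n S') (β' : SignedVecMeasure n T'),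
      α.skeleton = α'.skeleton → β.skeleton = β'.skeleton →
      (α.prod β).skeleton = (α'.prod β').skeleton) ∧
    -- hence the Lorenz product of Lorenz skeletons is well defined ...
    (∃! P : LorenzSkeleton.{u₁} n → LorenzSkeleton.{u₁} n → LorenzSkeleton.{u₁} n,
      IsLorenzProduct P) ∧
    -- ... and it is (jointly) continuous for the Hausdorff distance
    (∀ P : LorenzSkeleton.{u₁} n → LorenzSkeleton.{u₁} n → LorenzSkeleton.{u₁} n,
      IsLorenzProduct P →
      ∀ (K L : LorenzSkeleton.{u₁} n) (ε : ℝ), 0 < ε →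
        ∃ δ : ℝ, 0 < δ ∧ ∀ K' L' : LorenzSkeleton.{u₁} n,
          Metric.hausdorffDist K.1 K'.1 < δ → Metric.hausdorffDist L.1 L'.1 < δ →
          Metric.hausdorffDist (P K L).1 (P K' L').1 < ε) := by
  refine ⟨fun S T _ _ α β ε hε => α.exists_hausdorffDist_prod_lt β hε,
    fun S T S' T' _ _ _ _ α β α' β' => SignedVecMeasure.skeleton_prod_congr,
    existsUnique_isLorenzProduct n, ?_⟩
  rintro P hP ⟨_, S, _, α, rfl⟩ ⟨_, T, _, β, rfl⟩ ε hε
  obtain ⟨δ, hδ, h⟩ := α.exists_hausdorffDist_prod_lt β hε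
  refine ⟨δ, hδ, ?_⟩
  rintro ⟨_, S', _, α', rfl⟩ ⟨_, T', _, β', rfl⟩ hα hβ
  have e := congrArg Subtype.val (hP S T α β)
  have e' := congrArg Subtype.val (hP S' T' α' β')
  exact (congrArg₂ Metric.hausdorffDist e e').trans_lt (h S' T' α' β' hα hβ)
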